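/- For $a,b>0$ place four bodies at $q_1=(0,0)$, $q_2=(0,a)$, $q_3=(1,b)$, $q_4=(1,0)$, let $r_{ij}=|q_i-q_j|$ and $$D(a,b)=(r_{13}^3-r_{12}^3)(r_{23}^3-r_{34}^3)(r_{24}^3-r_{14}^3)-(r_{12}^3-r_{14}^3)(r_{24}^3-r_{34}^3)(r_{13}^3-r_{23}^3).$$ Let $$\Omega_r=\Big\{(a,b)\in\mathbb R^2:\ \tfrac{b^2+1}{2b}\le a<\sqrt{1+b^2},\ \ \tfrac1{\sqrt3}<b\le 1\Big\}$$ and $\Gamma=\{(a,b)\in\Omega_r: D(a,b)=0\}$. Then: 1. At every point of $\Gamma$ the partial derivative $\partial D/\partial a$ exists and is negative. 2. $\Gamma$ is a graph joining $(1,1)$ to $(2/\sqrt3,1/\sqrt3)$: there is a continuous function $\varphi:[1/\sqrt3,1]\to\mathbb R$ with $\varphi(1)=1$, $\varphi(1/\sqrt3)=2/\sqrt3$ and $\Gamma=\{(\varphi(b),b): 1/\sqrt3<b\le 1\}$. 3. $\Gamma$ is also a graph over the variable $a$: there is a continuous function $\psi:[1,2/\sqrt3]\to\mathbb R$ with $\psi(1)=1$,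 $\psi(2/\sqrt3)=1/\sqrt3$ and $\Gamma=\{(a,\psi(a)): 1\le a<2/\sqrt3\}$. 4. $\Gamma$ is a one-parameter family of right-trapezoid central configurations: for $(a,b)\in\Omega_r$ one has $(a,b)\in\Gamma$ if and only if there are masses $m_1=1$, $m_2,m_3,m_4>0$ for which $(q_1,q_2,q_3,q_4)$ is a central configuration of the Newtonian four-body problem, i.e. there is $\lambda>0$ with $$-\sum_{j\ne k} m_j\,\frac{q_k-q_j}{r_{kj}^3}=-\lambda\,(q_k-c)\quad(k=1,\dots,4),\qquad c=\frac{\sum_k m_kq_k}{\sum_k m_k}.$$ -/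

import Mathlib

open Set

noncomputable section

/-- The Newtonian acceleration (gravitational constant one) of the `k`-th of finitely many point
masses `m` placed at the points `q` of the plane. -/
def newtonAcceleration {n : ℕ} (m : Fin n → ℝ) (q : Fin n → EuclideanSpace ℝ (Fin 2))
    (k : Fin n) : EuclideanSpace ℝ (Fin 2) :=
  -∑ j ∈ Finset.univ.erase k, (m j / dist (q k) (q j) ^ 3) • (q k - q j)

/-- The center of mass. -/
def massCenter {n : ℕ} (m : Fin n → ℝ) (q : Fin n → EuclideanSpace ℝ (Fin 2)) :
    EuclideanSpace ℝ (Fin 2) :=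
  (∑ k, m k)⁻¹ • ∑ k, m k • q k

/-- The configuration `q` (no two bodies at the same place) is central for the masses `m`: the
accelerations are `-lam` times the positions relative to the center of mass, with one positive
constant `lam` for all bodies. -/
def IsCentralConfiguration {n : ℕ} (m : Fin n → ℝ) (q : Fin n → EuclideanSpace ℝ (Fin 2)) :
    Prop :=
  Function.Injective q ∧
    ∃ lam : ℝ, 0 < lam ∧ ∀ k, newtonAcceleration m q k = -(lam • (q k - massCenter m q))

/-- The left-hand side `D` of Dziobek's equation for four points in the plane; the four bodies
`1, 2, 3, 4` are numbered `0, 1, 2, 3` here. -/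
def dziobek (q : Fin 4 → EuclideanSpace ℝ (Fin 2)) : ℝ :=
  let r12 := dist (q 0) (q 1)
  let r13 := dist (q 0) (q 2)
  let r14 := dist (q 0) (q 3)
  let r23 := dist (q 1) (q 2)
  let r24 := dist (q 1) (q 3)
  let r34 := dist (q 2) (q 3)
  (r13 ^ 3 - r12 ^ 3) * (r23 ^ 3 - r34 ^ 3) * (r24 ^ 3 - r14 ^ 3) -
    (r12 ^ 3 - r14 ^ 3) * (r24 ^ 3 - r34 ^ 3) * (r13 ^ 3 - r23 ^ 3)

/-- The right trapezoid with vertices `(0, 0)`, `(0, a)`, `(1, b)`, `(1, 0)`. -/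
def rightTrapezoid (a b : ℝ) : Fin 4 → EuclideanSpace ℝ (Fin 2) :=
  ![!₂[0, 0], !₂[0, a], !₂[1, b], !₂[1, 0]]

/-- The region `Ω_r` of the parameters `(a, b)` of right trapezoids. -/
def rightRegion : Set (ℝ × ℝ) :=
  {p | (p.2 ^ 2 + 1) / (2 * p.2) ≤ p.1 ∧ p.1 < √(1 + p.2 ^ 2) ∧ 1 / √3 < p.2 ∧ p.2 ≤ 1}

/-- The curve `D = 0` in the region `Ω_r`. -/
def rightCurve : Set (ℝ × ℝ) :=
  {p | p ∈ rightRegion ∧ dziobek (rightTrapezoid p.1 p.2) = 0}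

end

/-!
Write `A = a³`, `B = b³`, `U = r₁₃³`, `W = r₂₄³`, `S = r₂₃³`, so that
`D = (U - A)(S - B)(W - 1) - (A - 1)(W - B)(U - S)`. In the region one has
`b ≤ 1 ≤ r₂₃ ≤ a ≤ r₁₃ ≤ r₂₄`, and both partial derivatives of `D` are negative on the whole region,
not only on the curve.

* For `∂D/∂a` (`TrapezoidDistances.partial_a_pos`) this is a matter of splitting
  `U - S = (U - A) + (A - S)` and comparing terms.
* For `∂D/∂b` (`TrapezoidDistances.partial_b_pos`) there is little room near `b = 1/√3`. The
  radicals are removed one after the other: `r₂₃` may be replaced by `a`, then `W - A` by a linear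
  function of `a`, and `r₁₃ = √(1 + b²)` by its tangent at `b = 3/4`. The polynomial in `a` and `b`
  that remains is expanded in powers of `2ab - b² - 1 ≥ 0`; its coefficients are positive by their
  Bernstein expansions (`reduced_polynomial_pos`).

On the arc `r₂₃ = r₁₂` of the boundary `D ≥ 0`, on the arc `r₁₂ = r₁₃` `D ≤ 0`, so every horizontal
line meets the closed curve exactly once, and the sign of `∂D/∂b` makes `a` a strictly decreasing
function of `b`. Continuity of this function and of its inverse holds because their graphs are
compact.

For central configurations put `Sᵢⱼ = rᵢⱼ⁻³ - λ/M`. The equations of motion give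
`S₁₂S₃₄ = S₁₃S₂₄ = S₁₄S₂₃`, and eliminating `λ/M` gives `D = 0`. Conversely `λ/M` is determined by
`S₁₃S₂₄ = S₁₄S₂₃` (`exists_shift`); it lies between the reciprocal cubes of the diagonals and those
of `r₁₄` and `r₂₃`, so the diagonals have `Sᵢⱼ < 0`, the sides `Sᵢⱼ > 0`, and the masses
`1, -S₁₃/S₂₃, aS₁₂/(bS₂₃), -aS₁₂S₁₃/(bS₁₄S₂₃)` are positive.
-/

/-! ### Polynomial inequalities -/

/-- Right trapezoids with parameters `(a, b)` in the region, which is described by polynomial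
inequalities, together with the distances `u = r₁₃`, `w = r₂₄`, `s = r₂₃`, which are given by their
squares. -/
structure TrapezoidDistances (a b u w s : ℝ) : Prop where
  a_pos : 0 < a
  b_pos : 0 < b
  b_le : b ≤ 1
  one_lt : 1 < 3 * b ^ 2
  le_two_mul : b ^ 2 + 1 ≤ 2 * a * b
  u_pos : 0 < u
  w_pos : 0 < w
  s_pos : 0 < s
  u_sq : u ^ 2 = 1 + b ^ 2
  w_sq : w ^ 2 = 1 + a ^ 2
  s_sq : s ^ 2 = 1 + (a - b) ^ 2
  a_lt_u : a < u

namespace TrapezoidDistances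

variable {a b u w s : ℝ}

lemma one_le_a (h : TrapezoidDistances a b u w s) : 1 ≤ a := by
  obtain ⟨ha, hb, hb1, -, h2, -⟩ := h
  nlinarith [sq_nonneg (b - 1)]

lemma b_le_a (h : TrapezoidDistances a b u w s) : b ≤ a := h.b_le.trans h.one_le_a

lemma s_le_a (h : TrapezoidDistances a b u w s) : s ≤ a := by
  have := h.le_two_mul
  exact (sq_le_sq₀ h.s_pos.le h.a_pos.le).1 (by rw [h.s_sq]; nlinarith)

lemma one_le_s (h : TrapezoidDistances a b u w s) : 1 ≤ s := by
  have := h.s_sq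
  nlinarith [sq_nonneg (a - b), h.s_pos]

lemma u_le_w (h : TrapezoidDistances a b u w s) : u ≤ w := by
  refine (sq_le_sq₀ h.u_pos.le h.w_pos.le).1 ?_
  rw [h.u_sq, h.w_sq]
  nlinarith [h.b_le_a, h.b_pos]

lemma a_sq_lt (h : TrapezoidDistances a b u w s) : a ^ 2 < 1 + b ^ 2 := by
  rw [← h.u_sq]
  exact pow_lt_pow_left₀ h.a_lt_u h.a_pos.le two_ne_zero

lemma u_lt_two_mul_b (h : TrapezoidDistances a b u w s) : u < 2 * b := by
  refine (sq_lt_sq₀ h.u_pos.le (by linarith [h.b_pos])).1 ?_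
  rw [h.u_sq]
  nlinarith [h.one_lt]

lemma four_sevenths_le_b (h : TrapezoidDistances a b u w s) : 4 / 7 ≤ b := by
  nlinarith [h.one_lt, h.b_pos]

lemma a_le_w (h : TrapezoidDistances a b u w s) : a ≤ w := h.a_lt_u.le.trans h.u_le_w

lemma cube_lt (h : TrapezoidDistances a b u w s) : a ^ 3 < u ^ 3 :=
  pow_lt_pow_left₀ h.a_lt_u h.a_pos.le three_ne_zero

/-- The partial derivative of `D` with respect to `a`, divided by `-3`, is positive. -/
lemma partial_a_pos (h : TrapezoidDistances a b u w s) :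
    0 < a ^ 2 * (s ^ 3 - b ^ 3) * (w ^ 3 - 1) - (u ^ 3 - a ^ 3) * (s * (a - b)) * (w ^ 3 - 1)
      - (u ^ 3 - a ^ 3) * (s ^ 3 - b ^ 3) * (a * w) + a ^ 2 * (w ^ 3 - b ^ 3) * (u ^ 3 - s ^ 3)
      + (a ^ 3 - 1) * (a * w) * (u ^ 3 - s ^ 3)
      - (a ^ 3 - 1) * (w ^ 3 - b ^ 3) * (s * (a - b)) := by
  have ha1 := h.one_le_a
  have hs1 := h.one_le_s
  have hb0 := h.b_pos
  have hba := h.b_le_a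
  have hsa := h.s_le_a
  have haw := h.a_le_w
  have hd : 0 ≤ a - b := by linarith
  have hX : 0 < u ^ 3 - a ^ 3 := sub_pos.2 h.cube_lt
  have hY : 0 ≤ a ^ 3 - s ^ 3 := sub_nonneg.2 (pow_le_pow_left₀ h.s_pos.le hsa 3)
  have hA : 0 ≤ a ^ 3 - 1 := sub_nonneg.2 (one_le_pow₀ ha1)
  have hB : 0 ≤ 1 - b ^ 3 := sub_nonneg.2 (pow_le_one₀ hb0.le h.b_le)
  have hWA : 0 ≤ w ^ 3 - a ^ 3 := sub_nonneg.2 (pow_le_pow_left₀ h.a_pos.le haw 3)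
  have hB0 : 0 ≤ b ^ 3 := by positivity
  have hsd : s * (a - b) ≤ a * (a - b) := mul_le_mul_of_nonneg_right hsa hd
  have hw := h.w_pos
  have ha := h.a_pos
  -- the coefficient of `u ^ 3 - a ^ 3` when `u ^ 3 - s ^ 3` is split at `a ^ 3`
  have hXc : 0 < a * w * (a ^ 3 - s ^ 3) + a ^ 2 * w ^ 3 - a * w + a * b ^ 3 * (w - a)
      - s * (a - b) * (w ^ 3 - 1) := by
    have h1 : 0 ≤ a * w * (a ^ 3 - s ^ 3) := by positivity
    have h2 : 0 ≤ a * b ^ 3 * (w - a) := mul_nonneg (by positivity) (by linarith)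
    have h3 : s * (a - b) * (w ^ 3 - 1) ≤ a * (a - b) * (w ^ 3 - 1) :=
      mul_le_mul_of_nonneg_right hsd (by linarith)
    have h4 : 1 < b * w ^ 2 := by
      rw [h.w_sq]; nlinarith [h.four_sevenths_le_b]
    have h5 : 0 < a * w * (b * w ^ 2 - 1) := mul_pos (by positivity) (by linarith)
    have h6 : 0 ≤ a * (a - b) := by positivity
    nlinarith
  have hYc : 0 ≤ (a ^ 3 - s ^ 3) * (a ^ 2 * (1 - b ^ 3) + (a ^ 3 - 1) * (a * w)) := by positivity
  have hrest : 0 ≤ a ^ 2 * (a ^ 3 - b ^ 3) * (w ^ 3 - 1)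
      - (a ^ 3 - 1) * (w ^ 3 - b ^ 3) * (s * (a - b)) := by
    have h1 : (a ^ 3 - 1) * (w ^ 3 - b ^ 3) ≤ (a ^ 3 - b ^ 3) * (w ^ 3 - 1) := by
      nlinarith [mul_nonneg hWA hB]
    have h2 : s * (a - b) ≤ a ^ 2 := by nlinarith
    have h3 : 0 ≤ (a ^ 3 - b ^ 3) * (w ^ 3 - 1) := mul_nonneg (by linarith) (by linarith)
    have h4 : 0 ≤ s * (a - b) := mul_nonneg h.s_pos.le hd
    nlinarith [mul_le_mul_of_nonneg_right h1 h4, mul_le_mul_of_nonneg_left h2 h3]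
  have hmain := mul_pos hX hXc
  linear_combination hmain + hYc + hrest

/-- A linear bound for `r₂₄³ - r₁₂³`; the right-hand side is close to the chord of this convex
function of `a` over `[1, √2]`. -/
lemma w_cube_le (h : TrapezoidDistances a b u w s) : w ^ 3 - a ^ 3 ≤ 4 / 3 * a + 1 / 2 := by
  have ha1 := h.one_le_a
  have hpoly : (1 + a ^ 2) ^ 3 ≤ (a ^ 3 + (4 / 3 * a + 1 / 2)) ^ 2 := by
    have h2 : a ^ 2 ≤ 2 := by nlinarith [h.a_sq_lt, h.b_le, h.b_pos]
    nlinarith [mul_nonneg (sub_nonneg.2 ha1) (sub_nonneg.2 h2),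
      mul_nonneg (mul_nonneg (sub_nonneg.2 ha1) (sub_nonneg.2 h2)) h.a_pos.le]
  have hw : (w ^ 3) ^ 2 = (1 + a ^ 2) ^ 3 := by rw [← h.w_sq]; ring
  have ha := h.a_pos
  have := (sq_le_sq₀ (pow_nonneg h.w_pos.le 3) (by positivity)).1 (hw.trans_le hpoly)
  linarith

end TrapezoidDistances

/-- The polynomial to which the sign of `∂D/∂b` is reduced is positive: multiplied by
`(2b)⁵`, it is a polynomial in `x = 2ab - b² - 1 ≥ 0` and `b`, and the coefficients of the powers of
`x` are positive for `4/7 ≤ b ≤ 1`, as their expansions in Bernstein polynomials (on `[4/7, 1]` for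
the constant one, on `[0, 1]` for the others) show. -/
lemma reduced_polynomial_pos {a b : ℝ} (hb : 4 / 7 ≤ b) (hb1 : b ≤ 1)
    (hx : b ^ 2 + 1 ≤ 2 * a * b) :
    0 < (4 / 3 * a + 1 / 2) * (a * (a - b) * ((4 / 5 + 3 / 5 * b) * (1 + b ^ 2) - 1)
        + b ^ 2 * ((4 / 5 + 3 / 5 * b) * (1 + b ^ 2) - a ^ 3)
        - (4 / 5 + 3 / 5 * b) * b * (1 - b ^ 3))
      + a * (a - b) * (a ^ 3 - 1) * ((4 / 5 + 3 / 5 * b) * (1 + b ^ 2) - b ^ 3) := by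
  set P := (4 / 3 * a + 1 / 2) * (a * (a - b) * ((4 / 5 + 3 / 5 * b) * (1 + b ^ 2) - 1)
        + b ^ 2 * ((4 / 5 + 3 / 5 * b) * (1 + b ^ 2) - a ^ 3)
        - (4 / 5 + 3 / 5 * b) * b * (1 - b ^ 3))
      + a * (a - b) * (a ^ 3 - 1) * ((4 / 5 + 3 / 5 * b) * (1 + b ^ 2) - b ^ 3) with hP
  have hb0 : 0 < b := by linarith
  have ht : 0 ≤ 1 - b := by linarith
  have hs : 0 ≤ 7 * b - 4 := by linarith
  have hc0 : 0 < 4/5 + 3/5*b + 32/15*b^2 - 79/15*b^3 + 14/5*b^4 - 368/15*b^5 - 18/5*b^6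
      - 178/15*b^7 + 186/5*b^8 + 737/15*b^9 + 574/15*b^10 + 61/3*b^11 - 4/5*b^12 + 2/5*b^13 := by
    have hbern : 0 < 109341369320*(1-b)^13 + 112049481111*(7*b-4)*(1-b)^12
        + 72577339104*(7*b-4)^2*(1-b)^11 + 83503494401*(7*b-4)^3*(1-b)^10
        + 83280557004*(7*b-4)^4*(1-b)^9 + 51339807270*(7*b-4)^5*(1-b)^8
        + 20475659370*(7*b-4)^6*(1-b)^7 + 5576790798*(7*b-4)^7*(1-b)^6
        + 1066936680*(7*b-4)^8*(1-b)^5 + 144177248*(7*b-4)^9*(1-b)^4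
        + 13533576*(7*b-4)^10*(1-b)^3 + 842304*(7*b-4)^11*(1-b)^2
        + 31328*(7*b-4)^12*(1-b) + 528*(7*b-4)^13 := by
      rcases hs.eq_or_lt with h0 | h0
      · have : b = 4 / 7 := by linarith
        subst this; norm_num
      · positivity
    linear_combination (1 / 7971615) * hbern
  have hc1 : 0 ≤ 4 + 3*b + 52/5*b^2 - 154/15*b^3 + 214/15*b^4 - 122/3*b^5 + 44/3*b^6 - 104/5*b^7
      + 274/15*b^8 + 173/15*b^9 - 12/5*b^10 + 6/5*b^11 := by
    have hbern : 0 ≤ 4*(1-b)^11 + 47*b*(1-b)^10 + 1302/5*b^2*(1-b)^9 + 2635/3*b^3*(1-b)^8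
        + 29798/15*b^4*(1-b)^7 + 9370/3*b^5*(1-b)^6 + 51146/15*b^6*(1-b)^5
        + 12418/5*b^7*(1-b)^4 + 5432/5*b^8*(1-b)^3 + 3296/15*b^9*(1-b)^2
        + 104/15*b^10*(1-b) + 16/5*b^11 := by positivity
    linear_combination hbern
  have hc2 : 0 ≤ 8 + 6*b + 96/5*b^2 - 34/5*b^3 + 338/15*b^4 - 26*b^5 + 106/15*b^6 - 82/5*b^7
      - 8/5*b^8 + 4/5*b^9 := by
    have hbern : 0 ≤ 8*(1-b)^9 + 78*b*(1-b)^8 + 1776/5*b^2*(1-b)^7 + 4838/5*b^3*(1-b)^6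
        + 25934/15*b^4*(1-b)^5 + 6254/3*b^5*(1-b)^4 + 8362/5*b^6*(1-b)^3 + 2494/3*b^7*(1-b)^2
        + 3136/15*b^8*(1-b) + 64/5*b^9 := by positivity
    linear_combination hbern
  have hc3 : 0 ≤ 8 + 6*b + 248/15*b^2 - 64/15*b^3 + 202/15*b^4 - 166/15*b^5 + 8/5*b^6
      - 4/5*b^7 := by
    have hbern : 0 ≤ 8*(1-b)^7 + 62*b*(1-b)^6 + 3308/15*b^2*(1-b)^5 + 2242/5*b^3*(1-b)^4
        + 8426/15*b^4*(1-b)^3 + 6406/15*b^5*(1-b)^2 + 2662/15*b^6*(1-b) + 442/15*b^7 := by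
      positivity
    linear_combination hbern
  have hc4 : 0 ≤ 4 + 3*b + 32/5*b^2 - 43/15*b^3 + 12/5*b^4 - 6/5*b^5 := by
    have hbern : 0 ≤ 4*(1-b)^5 + 23*b*(1-b)^4 + 292/5*b^2*(1-b)^3 + 223/3*b^3*(1-b)^2
        + 718/15*b^4*(1-b) + 176/15*b^5 := by positivity
    linear_combination hbern
  have hc5 : 0 ≤ 4/5 + 3/5*b + 4/5*b^2 - 2/5*b^3 := by
    have hbern : 0 ≤ 4/5*(1-b)^3 + 3*b*(1-b)^2 + 22/5*b^2*(1-b) + 9/5*b^3 := by positivity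
    linear_combination hbern
  have hx0 : 0 ≤ 2 * a * b - b ^ 2 - 1 := by linarith
  have key := add_pos_of_pos_of_nonneg hc0 <|
    add_nonneg (mul_nonneg hc1 hx0) <| add_nonneg (mul_nonneg hc2 (pow_nonneg hx0 2)) <|
    add_nonneg (mul_nonneg hc3 (pow_nonneg hx0 3)) <|
    add_nonneg (mul_nonneg hc4 (pow_nonneg hx0 4)) (mul_nonneg hc5 (pow_nonneg hx0 5))
  have hexp : 0 < (2 * b) ^ 5 * P := by
    rw [hP]
    linear_combination key
  exact pos_of_mul_pos_right hexp (by positivity)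

namespace TrapezoidDistances

variable {a b u w s : ℝ}

/-- The expression in `partial_b_pos` does not increase when `s` is replaced by `a`: the right-hand
side here is the difference. -/
lemma replace_s_nonneg (h : TrapezoidDistances a b u w s) :
    0 ≤ (w ^ 3 - 1) * (u * b * (a ^ 3 - s ^ 3) - (a - s) * (a - b) * (u ^ 3 - 1))
      - (a ^ 3 - 1) * ((1 - b ^ 3) * (a - b) * (a - s) + b ^ 2 * (a ^ 3 - s ^ 3)) := by
  have ha1 := h.one_le_a
  have hs1 := h.one_le_s
  have hb0 := h.b_pos
  have hb1 := h.b_le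
  have hsa := h.s_le_a
  have haw := h.a_le_w
  have hau := h.a_lt_u
  have hd : 0 ≤ a - b := sub_nonneg.2 h.b_le_a
  have hdb : a - b ≤ b := by linarith [h.u_lt_two_mul_b]
  have hU : u ^ 3 = u * (1 + b ^ 2) := by rw [← h.u_sq]; ring
  have ha2 : a ^ 2 ≤ 2 := by nlinarith [h.a_sq_lt]
  have hA : 0 ≤ a ^ 3 - 1 := sub_nonneg.2 (one_le_pow₀ ha1)
  have hB : 0 ≤ 1 - b ^ 3 := sub_nonneg.2 (pow_le_one₀ hb0.le hb1)
  have hU1 : 0 ≤ u ^ 3 - 1 := sub_nonneg.2 (one_le_pow₀ (by linarith))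
  have hW : 3 * (a ^ 3 - 1) ≤ 2 * (w ^ 3 - 1) := by
    have : a * (1 + a ^ 2) ≤ w ^ 3 := by
      calc a * (1 + a ^ 2) ≤ w * (1 + a ^ 2) := by gcongr
        _ = w ^ 3 := by rw [← h.w_sq]; ring
    nlinarith
  have hY : a ^ 3 - s ^ 3 = (a - s) * (a ^ 2 + a * s + s ^ 2) := by ring
  have hq : 3 ≤ a ^ 2 + a * s + s ^ 2 := by nlinarith
  have h1 : 2 ≤ 3 * u - u ^ 3 + 1 := by rw [hU]; nlinarith
  have h2 : 3 * b - b ^ 3 + 1 ≤ 3 := by nlinarith [mul_nonneg (sq_nonneg (b - 1)) hb0.le]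
  -- with `a - b ≤ b` and `3 ≤ a² + as + s²` this bounds the loss by the gain, after division by
  -- `a - s`
  have hdiff : (w ^ 3 - 1) * (u ^ 3 - 1) + (a ^ 3 - 1) * (1 - b ^ 3)
      ≤ 3 * ((w ^ 3 - 1) * u - (a ^ 3 - 1) * b) := by
    linear_combination mul_le_mul_of_nonneg_left h1 (by linarith : 0 ≤ w ^ 3 - 1)
      + mul_le_mul_of_nonneg_left h2 hA + hW
  have hM : 0 ≤ (w ^ 3 - 1) * (u ^ 3 - 1) + (a ^ 3 - 1) * (1 - b ^ 3) :=
    add_nonneg (mul_nonneg (by linarith) hU1) (mul_nonneg hA hB)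
  have h3 : 0 ≤ (w ^ 3 - 1) * u - (a ^ 3 - 1) * b := by linarith
  have h4 : (a - b) * ((w ^ 3 - 1) * (u ^ 3 - 1) + (a ^ 3 - 1) * (1 - b ^ 3))
      ≤ b * ((a ^ 2 + a * s + s ^ 2) * ((w ^ 3 - 1) * u - (a ^ 3 - 1) * b)) := by
    gcongr
    exact hdiff.trans (mul_le_mul_of_nonneg_right hq h3)
  rw [hY]
  have h5 := mul_nonneg (sub_nonneg.2 hsa) (sub_nonneg.2 h4)
  linear_combination h5

/-- The partial derivative of `D` with respect to `b`, divided by `-3`, is positive. Replacing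
`s` by `a` decreases it, and the result is linear in `w ^ 3 - a ^ 3` and increasing in `u`, so the
linear bounds `w ^ 3 - a ^ 3 ≤ 4a/3 + 1/2` and `u ≥ (4 + 3b)/5` reduce it to a polynomial. -/
lemma partial_b_pos (h : TrapezoidDistances a b u w s) :
    0 < (w ^ 3 - 1) * ((u ^ 3 - a ^ 3) * (s * (a - b) + b ^ 2) - u * b * (s ^ 3 - b ^ 3))
      + (a ^ 3 - 1) * ((w ^ 3 - b ^ 3) * (u * b + s * (a - b)) - b ^ 2 * (u ^ 3 - s ^ 3)) := by
  have ha1 := h.one_le_a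
  have hb0 := h.b_pos
  have hb1 := h.b_le
  have hba := h.b_le_a
  have hau := h.a_lt_u
  have hu := h.u_pos
  have ha := h.a_pos
  have hd : 0 ≤ a - b := by linarith
  have hu2 := h.u_sq
  have hU : u ^ 3 = u * (1 + b ^ 2) := by rw [← hu2]; ring
  have hA : 0 ≤ a ^ 3 - 1 := sub_nonneg.2 (one_le_pow₀ ha1)
  have hWA : 0 < w ^ 3 - a ^ 3 :=
    sub_pos.2 (pow_lt_pow_left₀ (hau.trans_le h.u_le_w) ha.le three_ne_zero)
  have hstep := h.replace_s_nonneg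
  have hQ := reduced_polynomial_pos h.four_sevenths_le_b hb1 h.le_two_mul
  -- the tangent of `√(1 + b²)` at `b = 3/4`
  have hl : 4 / 5 + 3 / 5 * b ≤ u := by
    refine (sq_le_sq₀ (by positivity) hu.le).1 ?_
    rw [hu2]; nlinarith [sq_nonneg (4 * b - 3)]
  have hmono : 0 ≤ (1 + b ^ 2) * (a * (a - b) + b ^ 2) - b * (1 - b ^ 3) := by
    have : 3 / 4 ≤ a * (a - b) + b ^ 2 := by nlinarith [sq_nonneg (a - 2 * b)]
    nlinarith [mul_le_mul_of_nonneg_left this (by positivity : 0 ≤ 1 + b ^ 2),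
      sq_nonneg (3 * b - 2), sq_nonneg (b ^ 2)]
  have hV : 0 < 4 / 3 * a + 1 / 2 := by positivity
  set T := a * (a - b) * (u ^ 3 - 1) + b ^ 2 * (u ^ 3 - a ^ 3) - u * b * (1 - b ^ 3) with hT
  have hVT : 0 < (4 / 3 * a + 1 / 2) * T + a * (a - b) * (a ^ 3 - 1) * (u ^ 3 - b ^ 3) := by
    have h1 := mul_nonneg hV.le (mul_nonneg (sub_nonneg.2 hl) hmono)
    have h2 : 0 ≤ a * (a - b) * (a ^ 3 - 1) * ((1 + b ^ 2) * (u - (4 / 5 + 3 / 5 * b))) :=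
      mul_nonneg (mul_nonneg (mul_nonneg ha.le hd) hA)
        (mul_nonneg (by positivity) (sub_nonneg.2 hl))
    rw [hT, hU]
    linear_combination hQ + h1 + h2
  have hrest : 0 ≤ a * (a - b) * (a ^ 3 - 1) * (u ^ 3 - b ^ 3) :=
    mul_nonneg (mul_nonneg (mul_nonneg ha.le hd) hA)
      (sub_nonneg.2 (pow_le_pow_left₀ hb0.le (hba.trans hau.le) 3))
  have hred : 0 < (w ^ 3 - a ^ 3) * T + a * (a - b) * (a ^ 3 - 1) * (u ^ 3 - b ^ 3) := by
    rcases le_or_gt T 0 with hT0 | hT0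
    · exact hVT.trans_le (add_le_add (mul_le_mul_of_nonpos_right h.w_cube_le hT0) le_rfl)
    · exact add_pos_of_pos_of_nonneg (mul_pos hWA hT0) hrest
  rw [hT] at hred
  linear_combination hred + hstep

end TrapezoidDistances

/-! ### Dziobek's equation for right trapezoids -/

/-- Dziobek's expression `D(a, b)` of a right trapezoid, with the distances written out. -/
noncomputable def trapezoidD (a b : ℝ) : ℝ :=
  (√(1 + b ^ 2) ^ 3 - a ^ 3) * (√(1 + (a - b) ^ 2) ^ 3 - b ^ 3) * (√(1 + a ^ 2) ^ 3 - 1) -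
    (a ^ 3 - 1) * (√(1 + a ^ 2) ^ 3 - b ^ 3) * (√(1 + b ^ 2) ^ 3 - √(1 + (a - b) ^ 2) ^ 3)

section Distances

variable {a b : ℝ}

lemma dist_rightTrapezoid_zero_one (ha : 0 < a) :
    dist (rightTrapezoid a b 0) (rightTrapezoid a b 1) = a := by
  simp [rightTrapezoid, EuclideanSpace.dist_eq, Real.dist_eq, Real.sqrt_sq ha.le]

lemma dist_rightTrapezoid_zero_two :
    dist (rightTrapezoid a b 0) (rightTrapezoid a b 2) = √(1 + b ^ 2) := by
  simp [rightTrapezoid, EuclideanSpace.dist_eq, Real.dist_eq]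

lemma dist_rightTrapezoid_zero_three :
    dist (rightTrapezoid a b 0) (rightTrapezoid a b 3) = 1 := by
  simp [rightTrapezoid, EuclideanSpace.dist_eq, Real.dist_eq]

lemma dist_rightTrapezoid_one_two :
    dist (rightTrapezoid a b 1) (rightTrapezoid a b 2) = √(1 + (a - b) ^ 2) := by
  simp [rightTrapezoid, EuclideanSpace.dist_eq, Real.dist_eq]

lemma dist_rightTrapezoid_one_three :
    dist (rightTrapezoid a b 1) (rightTrapezoid a b 3) = √(1 + a ^ 2) := by
  simp [rightTrapezoid, EuclideanSpace.dist_eq, Real.dist_eq]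

lemma dist_rightTrapezoid_two_three (hb : 0 < b) :
    dist (rightTrapezoid a b 2) (rightTrapezoid a b 3) = b := by
  simp [rightTrapezoid, EuclideanSpace.dist_eq, Real.dist_eq, Real.sqrt_sq hb.le]

lemma dziobek_rightTrapezoid (ha : 0 < a) (hb : 0 < b) :
    dziobek (rightTrapezoid a b) = trapezoidD a b := by
  simp only [dziobek, trapezoidD, dist_rightTrapezoid_zero_one ha, dist_rightTrapezoid_zero_two,
    dist_rightTrapezoid_zero_three, dist_rightTrapezoid_one_two, dist_rightTrapezoid_one_three,
    dist_rightTrapezoid_two_three hb, one_pow]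

end Distances

lemma continuous_trapezoidD : Continuous fun p : ℝ × ℝ => trapezoidD p.1 p.2 := by
  unfold trapezoidD
  fun_prop

lemma HasDerivAt.sqrt_one_add_sq_cube {f : ℝ → ℝ} {f' x : ℝ} (hf : HasDerivAt f f' x) :
    HasDerivAt (fun x => √(1 + f x ^ 2) ^ 3) (3 * (√(1 + f x ^ 2) * f x) * f') x := by
  have h0 : 0 < 1 + f x ^ 2 := by positivity
  have hs : √(1 + f x ^ 2) ≠ 0 := (Real.sqrt_pos.2 h0).ne'
  refine ((((hf.pow 2).const_add 1).sqrt h0.ne').pow 3).congr_deriv ?_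
  simp only [Pi.pow_apply]
  field_simp
  ring

lemma hasDerivAt_trapezoidD_left (a b : ℝ) :
    HasDerivAt (fun x => trapezoidD x b)
      (-3 * (a ^ 2 * (√(1 + (a - b) ^ 2) ^ 3 - b ^ 3) * (√(1 + a ^ 2) ^ 3 - 1)
        - (√(1 + b ^ 2) ^ 3 - a ^ 3) * (√(1 + (a - b) ^ 2) * (a - b)) * (√(1 + a ^ 2) ^ 3 - 1)
        - (√(1 + b ^ 2) ^ 3 - a ^ 3) * (√(1 + (a - b) ^ 2) ^ 3 - b ^ 3) * (a * √(1 + a ^ 2))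
        + a ^ 2 * (√(1 + a ^ 2) ^ 3 - b ^ 3) * (√(1 + b ^ 2) ^ 3 - √(1 + (a - b) ^ 2) ^ 3)
        + (a ^ 3 - 1) * (a * √(1 + a ^ 2)) * (√(1 + b ^ 2) ^ 3 - √(1 + (a - b) ^ 2) ^ 3)
        - (a ^ 3 - 1) * (√(1 + a ^ 2) ^ 3 - b ^ 3) * (√(1 + (a - b) ^ 2) * (a - b)))) a := by
  have hs := ((hasDerivAt_id a).sub_const b).sqrt_one_add_sq_cube
  have hw := (hasDerivAt_id a).sqrt_one_add_sq_cube
  have ha := hasDerivAt_pow 3 a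
  simp only [id] at hs hw
  refine (((ha.const_sub _).mul (hs.sub_const (b ^ 3))).mul (hw.sub_const 1) |>.sub
    (((ha.sub_const 1).mul (hw.sub_const (b ^ 3))).mul
      (hs.const_sub (√(1 + b ^ 2) ^ 3)))).congr_deriv ?_
  simp only [Pi.mul_apply]
  push_cast
  ring

lemma hasDerivAt_trapezoidD_right (a b : ℝ) :
    HasDerivAt (fun y => trapezoidD a y)
      (-3 * ((√(1 + a ^ 2) ^ 3 - 1) * ((√(1 + b ^ 2) ^ 3 - a ^ 3)
          * (√(1 + (a - b) ^ 2) * (a - b) + b ^ 2)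
          - √(1 + b ^ 2) * b * (√(1 + (a - b) ^ 2) ^ 3 - b ^ 3))
        + (a ^ 3 - 1) * ((√(1 + a ^ 2) ^ 3 - b ^ 3)
          * (√(1 + b ^ 2) * b + √(1 + (a - b) ^ 2) * (a - b))
          - b ^ 2 * (√(1 + b ^ 2) ^ 3 - √(1 + (a - b) ^ 2) ^ 3)))) b := by
  have hs := ((hasDerivAt_id b).const_sub a).sqrt_one_add_sq_cube
  have hu := (hasDerivAt_id b).sqrt_one_add_sq_cube
  have hb := hasDerivAt_pow 3 b
  simp only [id] at hs hu
  refine (((hu.sub_const (a ^ 3)).mul (hs.sub hb)).mul_const (√(1 + a ^ 2) ^ 3 - 1) |>.sub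
    (((hb.const_sub (√(1 + a ^ 2) ^ 3)).const_mul (a ^ 3 - 1)).mul (hu.sub hs))).congr_deriv ?_
  simp only [Pi.sub_apply]
  push_cast
  ring

/-- The parameter region with its boundary, described by polynomial inequalities. -/
def closedRegion : Set (ℝ × ℝ) :=
  {p | p.2 ^ 2 + 1 ≤ 2 * p.1 * p.2 ∧ p.1 ^ 2 ≤ 1 + p.2 ^ 2 ∧ 0 ≤ p.1 ∧ 1 / √3 ≤ p.2 ∧ p.2 ≤ 1}

lemma one_div_sqrt_three_pos : 0 < 1 / √3 := by positivity

lemma one_div_sqrt_three_sq : (1 / √3) ^ 2 = 1 / 3 := by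
  rw [div_pow, Real.sq_sqrt (by norm_num)]; norm_num

lemma two_div_sqrt_three_sq : (2 / √3) ^ 2 = 4 / 3 := by
  rw [div_pow, Real.sq_sqrt (by norm_num)]; norm_num

lemma one_div_sqrt_three_lt_one : 1 / √3 < 1 := by
  nlinarith [one_div_sqrt_three_sq, one_div_sqrt_three_pos]

lemma one_lt_three_mul_sq {b : ℝ} (hb : 1 / √3 < b) : 1 < 3 * b ^ 2 := by
  nlinarith [one_div_sqrt_three_sq, one_div_sqrt_three_pos]

lemma mem_rightRegion_iff {a b : ℝ} :
    (a, b) ∈ rightRegion ↔ (a, b) ∈ closedRegion ∧ a < √(1 + b ^ 2) ∧ 1 / √3 < b := by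
  simp only [rightRegion, closedRegion, mem_ofPred_eq]
  constructor
  · rintro ⟨h1, h2, h3, h4⟩
    have hb : 0 < b := one_div_sqrt_three_pos.trans h3
    rw [div_le_iff₀ (by positivity)] at h1
    have ha : 0 ≤ a := by nlinarith
    refine ⟨⟨by linarith, ?_, ha, h3.le, h4⟩, h2, h3⟩
    exact ((Real.lt_sqrt ha).1 h2).le
  · rintro ⟨⟨h1, -, -, -, h4⟩, h2, h3⟩
    have hb : 0 < b := one_div_sqrt_three_pos.trans h3
    refine ⟨?_, h2, h3, h4⟩
    rw [div_le_iff₀ (by positivity)]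
    linarith

lemma trapezoidDistances_of_mem {a b : ℝ} (h : (a, b) ∈ closedRegion) (hb : 1 / √3 < b)
    (ha : a < √(1 + b ^ 2)) :
    TrapezoidDistances a b √(1 + b ^ 2) √(1 + a ^ 2) √(1 + (a - b) ^ 2) := by
  obtain ⟨h1, -, h3, -, h5⟩ := h
  dsimp only at h1 h3 h5
  have hb0 : 0 < b := one_div_sqrt_three_pos.trans hb
  refine ⟨by nlinarith, hb0, h5, one_lt_three_mul_sq hb, h1, by positivity, by positivity,
    by positivity, ?_, ?_, ?_, ha⟩ <;>
  exact Real.sq_sqrt (by positivity)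

lemma mem_closedRegion_pos {a b : ℝ} (h : (a, b) ∈ closedRegion) : 0 < a ∧ 0 < b := by
  obtain ⟨h1, -, h3, h4, -⟩ := h
  dsimp only at h1 h3 h4
  have hb0 : 0 < b := one_div_sqrt_three_pos.trans_le h4
  exact ⟨by nlinarith, hb0⟩

lemma isCompact_closedRegion : IsCompact closedRegion := by
  refine (isCompact_Icc (a := ((0, 0) : ℝ × ℝ)) (b := (2, 1))).of_isClosed_subset ?_ ?_
  · simp only [closedRegion, ofPred_and]
    refine IsClosed.inter ?_ (IsClosed.inter ?_ (IsClosed.inter ?_ (IsClosed.inter ?_ ?_))) <;>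
    exact isClosed_le (by fun_prop) (by fun_prop)
  · rintro ⟨a, b⟩ h
    obtain ⟨ha, hb⟩ := mem_closedRegion_pos h
    obtain ⟨-, h2, -, -, h5⟩ := h
    dsimp only at h2 h5
    exact ⟨⟨ha.le, hb.le⟩, by dsimp only; nlinarith, h5⟩

/-- On the boundary arc `r₂₃ = r₁₂` of the region the expression `D` is nonnegative. -/
lemma trapezoidD_nonneg {a b : ℝ} (h : (a, b) ∈ closedRegion) (he : b ^ 2 + 1 = 2 * a * b) :
    0 ≤ trapezoidD a b := by
  obtain ⟨ha, hb⟩ := mem_closedRegion_pos h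
  obtain ⟨-, h2, -, -, h5⟩ := h
  dsimp only at h2 h5
  have hs : √(1 + (a - b) ^ 2) = a := by
    rw [show 1 + (a - b) ^ 2 = a ^ 2 by linear_combination he, Real.sqrt_sq ha.le]
  have hu : a ^ 3 ≤ √(1 + b ^ 2) ^ 3 := pow_le_pow_left₀ ha.le (Real.le_sqrt_of_sq_le h2) 3
  have hw : a ^ 3 ≤ √(1 + a ^ 2) ^ 3 :=
    pow_le_pow_left₀ ha.le (Real.le_sqrt_of_sq_le (by linarith)) 3
  have hB : b ^ 3 ≤ 1 := pow_le_one₀ hb.le h5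
  have := mul_nonneg (mul_nonneg (sub_nonneg.2 hu) (sub_nonneg.2 hB)) (sub_nonneg.2 hw)
  unfold trapezoidD
  rw [hs]
  linear_combination this

/-- On the boundary arc `r₁₂ = r₁₃` of the region, except for its endpoint at `b = 1 / √3`, the
expression `D` is negative. -/
lemma trapezoidD_neg {b : ℝ} (hb : 1 / √3 < b) (hb1 : b ≤ 1) :
    trapezoidD √(1 + b ^ 2) b < 0 := by
  have hb0 : 0 < b := one_div_sqrt_three_pos.trans hb
  set u := √(1 + b ^ 2) with hu
  have hu2 : u ^ 2 = 1 + b ^ 2 := Real.sq_sqrt (by positivity)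
  have hu1 : 1 < u := by rw [hu]; exact Real.lt_sqrt_of_sq_lt (by nlinarith)
  have hu2b : u < 2 * b := by
    rw [hu, Real.sqrt_lt' (by positivity)]
    nlinarith [one_lt_three_mul_sq hb]
  have hA : 0 < u ^ 3 - 1 := sub_pos.2 (one_lt_pow₀ hu1 three_ne_zero)
  have hw : b ^ 3 < √(1 + u ^ 2) ^ 3 := by
    refine pow_lt_pow_left₀ (Real.lt_sqrt_of_sq_lt ?_) hb0.le three_ne_zero
    nlinarith
  have hs : √(1 + (u - b) ^ 2) ^ 3 < u ^ 3 := by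
    refine pow_lt_pow_left₀ ?_ (by positivity) three_ne_zero
    rw [Real.sqrt_lt' (by linarith)]
    nlinarith
  have := mul_pos (mul_pos hA (sub_pos.2 hw)) (sub_pos.2 hs)
  unfold trapezoidD
  rw [← hu]
  linear_combination this

lemma two_div_sqrt_three_mul_one_div_sqrt_three : 2 / √3 * (1 / √3) = 2 / 3 := by
  have := one_div_sqrt_three_sq
  linear_combination 2 * this

lemma corner_mem_closedRegion : (2 / √3, 1 / √3) ∈ closedRegion := by
  have h1 := two_div_sqrt_three_sq
  have h2 := one_div_sqrt_three_sq
  have h3 := two_div_sqrt_three_mul_one_div_sqrt_three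
  refine ⟨?_, ?_, by positivity, le_rfl, one_div_sqrt_three_lt_one.le⟩ <;> dsimp only <;> linarith

lemma trapezoidD_corner : trapezoidD (2 / √3) (1 / √3) = 0 := by
  have h1 := two_div_sqrt_three_sq
  have h2 := one_div_sqrt_three_sq
  have h3 := two_div_sqrt_three_mul_one_div_sqrt_three
  have ha : 0 ≤ 2 / √3 := by positivity
  have hu : √(1 + (1 / √3) ^ 2) = 2 / √3 := by
    rw [show 1 + (1 / √3) ^ 2 = (2 / √3) ^ 2 by linarith, Real.sqrt_sq ha]
  have hs : √(1 + (2 / √3 - 1 / √3) ^ 2) = 2 / √3 := by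
    rw [show 1 + (2 / √3 - 1 / √3) ^ 2 = (2 / √3) ^ 2 by
      linear_combination h2 - 2 * h3, Real.sqrt_sq ha]
  unfold trapezoidD
  rw [hu, hs]
  ring

/-- The two boundary arcs of the region meet at `b = 1 / √3`. -/
lemma eq_of_mem_closedRegion {a : ℝ} (h : (a, 1 / √3) ∈ closedRegion) : a = 2 / √3 := by
  obtain ⟨h1, h2, h3, -, -⟩ := h
  dsimp only at h1 h2 h3
  have h4 := one_div_sqrt_three_sq
  have h5 : 2 / √3 = 2 * (1 / √3) := by ring
  have h6 := one_div_sqrt_three_pos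
  rw [h5]
  set c := 1 / √3
  refine le_antisymm ?_ ?_
  · nlinarith
  · nlinarith

lemma one_one_mem_closedRegion : ((1, 1) : ℝ × ℝ) ∈ closedRegion :=
  ⟨by norm_num, by norm_num, by norm_num, one_div_sqrt_three_lt_one.le, le_rfl⟩

lemma trapezoidD_one_one : trapezoidD 1 1 = 0 := by
  simp [trapezoidD]

/-! ### The curve as a graph over both coordinates -/

lemma mem_closedRegion_of_mem_Icc {x y z b : ℝ} (hx : (x, b) ∈ closedRegion)
    (hy : (y, b) ∈ closedRegion) (hz : z ∈ Icc x y) : (z, b) ∈ closedRegion := by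
  obtain ⟨hx0, hb0⟩ := mem_closedRegion_pos hx
  obtain ⟨h1, -, -, h4, h5⟩ := hx
  obtain ⟨-, h2, -, -, -⟩ := hy
  obtain ⟨hz1, hz2⟩ := hz
  dsimp only at *
  exact ⟨by dsimp only; nlinarith, by dsimp only; nlinarith, by dsimp only; linarith, h4, h5⟩

lemma trapezoidD_lt_of_lt_left {x y b : ℝ} (hx : (x, b) ∈ closedRegion)
    (hy : (y, b) ∈ closedRegion) (hb : 1 / √3 < b) (hxy : x < y) :
    trapezoidD y b < trapezoidD x b := by
  refine strictAntiOn_of_deriv_neg (f := fun x => trapezoidD x b) (convex_Icc x y)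
    (fun z _ => (hasDerivAt_trapezoidD_left z b).continuousAt.continuousWithinAt) (fun z hz => ?_)
    (left_mem_Icc.2 hxy.le) (right_mem_Icc.2 hxy.le) hxy
  rw [interior_Icc] at hz
  have hmem := mem_closedRegion_of_mem_Icc hx hy (Ioo_subset_Icc_self hz)
  have hlt : z < √(1 + b ^ 2) := hz.2.trans_le (Real.le_sqrt_of_sq_le hy.2.1)
  have := (trapezoidDistances_of_mem hmem hb hlt).partial_a_pos
  rw [(hasDerivAt_trapezoidD_left z b).deriv]
  linarith

lemma one_le_of_mem_closedRegion {a b : ℝ} (h : (a, b) ∈ closedRegion) : 1 ≤ a := by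
  obtain ⟨ha, hb⟩ := mem_closedRegion_pos h
  obtain ⟨h1, -⟩ := h
  dsimp only at h1
  nlinarith [sq_nonneg (b - 1)]

lemma mem_closedRegion_of_le {a b c : ℝ} (h : (a, b) ∈ closedRegion) (hbc : b ≤ c)
    (hc : c ≤ 1) : (a, c) ∈ closedRegion := by
  have ha1 := one_le_of_mem_closedRegion h
  obtain ⟨ha, hb⟩ := mem_closedRegion_pos h
  obtain ⟨h1, h2, h3, h4, h5⟩ := h
  dsimp only at *
  refine ⟨?_, by dsimp only; nlinarith, h3, h4.trans hbc, hc⟩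
  dsimp only
  -- `y ↦ y² - 2ay + 1` is convex and nonpositive at `b` and at `1`
  rcases hbc.eq_or_lt with rfl | hbc
  · exact h1
  · have hb1 : 0 < 1 - b := by linarith
    have key : 0 ≤ (1 - b) * (2 * a * c - c ^ 2 - 1) := by
      have e1 := mul_nonneg (sub_nonneg.2 hbc.le) (sub_nonneg.2 ha1)
      have e2 := mul_nonneg (sub_nonneg.2 hc) (sub_nonneg.2 h1)
      have e3 := mul_nonneg hb1.le (mul_nonneg (sub_nonneg.2 hbc.le) (sub_nonneg.2 hc))
      linear_combination 2 * e1 + e2 + e3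
    linarith [nonneg_of_mul_nonneg_right key hb1]

lemma trapezoidD_lt_of_lt_right {a b c : ℝ} (hb : (a, b) ∈ closedRegion) (hc : c ≤ 1)
    (hbc : b < c) : trapezoidD a c < trapezoidD a b := by
  refine strictAntiOn_of_deriv_neg (f := trapezoidD a) (convex_Icc b c)
    (fun z _ => (hasDerivAt_trapezoidD_right a z).continuousAt.continuousWithinAt) (fun z hz => ?_)
    (left_mem_Icc.2 hbc.le) (right_mem_Icc.2 hbc.le) hbc
  rw [interior_Icc] at hz
  have hmem := mem_closedRegion_of_le hb hz.1.le (hz.2.le.trans hc)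
  have hb0 := (mem_closedRegion_pos hb).2
  have hlt : a < √(1 + z ^ 2) := by
    refine Real.lt_sqrt_of_sq_lt (hb.2.1.trans_lt ?_)
    dsimp only
    nlinarith [hz.1]
  have := (trapezoidDistances_of_mem hmem (hb.2.2.2.1.trans_lt hz.1) hlt).partial_b_pos
  rw [(hasDerivAt_trapezoidD_right a z).deriv]
  linarith

/-- The curve `D = 0` together with its endpoint at `b = 1 / √3`. -/
def closedCurve : Set (ℝ × ℝ) :=
  {p | p ∈ closedRegion ∧ trapezoidD p.1 p.2 = 0}

lemma isCompact_closedCurve : IsCompact closedCurve :=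
  isCompact_closedRegion.inter_right
    (isClosed_eq continuous_trapezoidD continuous_const)

lemma mem_rightCurve_iff {a b : ℝ} : (a, b) ∈ rightCurve ↔ (a, b) ∈ closedCurve ∧ 1 / √3 < b := by
  constructor
  · rintro ⟨h, hD⟩
    obtain ⟨h1, -, h3⟩ := mem_rightRegion_iff.1 h
    obtain ⟨ha, hb⟩ := mem_closedRegion_pos h1
    rw [dziobek_rightTrapezoid ha hb] at hD
    exact ⟨⟨h1, hD⟩, h3⟩
  · rintro ⟨⟨h1, hD⟩, h3⟩
    obtain ⟨ha, hb⟩ := mem_closedRegion_pos h1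
    dsimp only at hD
    refine ⟨mem_rightRegion_iff.2 ⟨h1, ?_, h3⟩, (dziobek_rightTrapezoid ha hb).trans hD⟩
    refine (Real.le_sqrt_of_sq_le h1.2.1).lt_of_ne fun he => ?_
    dsimp only at he
    rw [he] at hD
    exact (trapezoidD_neg h3 h1.2.2.2.2).ne hD

lemma exists_mem_closedCurve {b : ℝ} (hb : b ∈ Icc (1 / √3) 1) : ∃ a, (a, b) ∈ closedCurve := by
  obtain ⟨hb, hb1⟩ := hb
  rcases hb.eq_or_lt with rfl | hb
  · exact ⟨2 / √3, corner_mem_closedRegion, trapezoidD_corner⟩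
  have hb0 : 0 < b := one_div_sqrt_three_pos.trans hb
  set l := (b ^ 2 + 1) / (2 * b) with hl
  have hlb : b ^ 2 + 1 = 2 * l * b := by rw [hl]; field_simp
  have hl0 : 0 < l := by positivity
  set u := √(1 + b ^ 2) with hu
  have hu2 : u ^ 2 = 1 + b ^ 2 := Real.sq_sqrt (by positivity)
  have hu0 : 0 < u := Real.sqrt_pos.2 (by positivity)
  have hlu : l ^ 2 ≤ u ^ 2 := by
    have h3 := one_lt_three_mul_sq hb
    rw [hl, div_pow, div_le_iff₀ (by positivity), hu2]
    nlinarith [mul_nonneg (by positivity : 0 ≤ 1 + b ^ 2) (by linarith : 0 ≤ 3 * b ^ 2 - 1)]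
  have hlu' : l ≤ u := (sq_le_sq₀ hl0.le hu0.le).1 hlu
  have hlmem : (l, b) ∈ closedRegion := ⟨hlb.le, hlu.trans hu2.le, hl0.le, hb.le, hb1⟩
  have humem : (u, b) ∈ closedRegion := ⟨by dsimp only; nlinarith, hu2.le, hu0.le, hb.le, hb1⟩
  obtain ⟨a, ha, hD⟩ := intermediate_value_Icc' (f := fun x => trapezoidD x b) hlu'
    (fun z _ => (hasDerivAt_trapezoidD_left z b).continuousAt.continuousWithinAt)
    ⟨(trapezoidD_neg hb hb1).le, trapezoidD_nonneg hlmem hlb⟩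
  exact ⟨a, mem_closedRegion_of_mem_Icc hlmem humem ha, hD⟩

lemma closedCurve_fst_unique {a a' b : ℝ} (h : (a, b) ∈ closedCurve) (h' : (a', b) ∈ closedCurve) :
    a = a' := by
  rcases (h.1.2.2.2.1 : 1 / √3 ≤ b).eq_or_lt with rfl | hb
  · rw [eq_of_mem_closedRegion h.1, eq_of_mem_closedRegion h'.1]
  · have e := h.2
    have e' := h'.2
    dsimp only at e e'
    rcases lt_trichotomy a a' with hlt | heq | hlt
    · linarith [trapezoidD_lt_of_lt_left h.1 h'.1 hb hlt]
    · exact heq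
    · linarith [trapezoidD_lt_of_lt_left h'.1 h.1 hb hlt]

/-- The curve descends: a larger `b` forces a smaller `a`. -/
lemma closedCurve_fst_lt {a a' b b' : ℝ} (h : (a, b) ∈ closedCurve) (h' : (a', b') ∈ closedCurve)
    (hbb : b < b') : a' < a := by
  have hb1 : b' ≤ 1 := h'.1.2.2.2.2
  have hmem := mem_closedRegion_of_le h.1 hbb.le hb1
  have hneg := trapezoidD_lt_of_lt_right h.1 hb1 hbb
  have e := h.2
  have e' := h'.2
  dsimp only at e e'
  by_contra! hle
  rcases hle.eq_or_lt with rfl | hlt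
  · linarith
  · linarith [trapezoidD_lt_of_lt_left hmem h'.1 ((h.1.2.2.2.1 : 1 / √3 ≤ b).trans_lt hbb) hlt]

/-- A function with compact graph is continuous. -/
lemma continuousOn_of_isCompact_graph {X Y : Type*} [TopologicalSpace X] [T2Space X]
    [TopologicalSpace Y] {f : X → Y} {s : Set X}
    (h : IsCompact {p : X × Y | p.1 ∈ s ∧ p.2 = f p.1}) : ContinuousOn f s := by
  rw [continuousOn_iff_isClosed]
  intro t ht
  refine ⟨Prod.fst '' ({p : X × Y | p.1 ∈ s ∧ p.2 = f p.1} ∩ Prod.snd ⁻¹' t),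
    ((h.inter_right (ht.preimage continuous_snd)).image continuous_fst).isClosed, ?_⟩
  ext x
  constructor
  · rintro ⟨hx, hxs⟩
    exact ⟨⟨(x, f x), ⟨⟨hxs, rfl⟩, hx⟩, rfl⟩, hxs⟩
  · rintro ⟨⟨p, ⟨⟨hs, hf⟩, hy⟩, rfl⟩, -⟩
    exact ⟨by rwa [mem_preimage, ← hf], hs⟩

/-- The curve is the graph of a continuous function of `b`. -/
lemma exists_graph_snd : ∃ φ : ℝ → ℝ, ContinuousOn φ (Icc (1 / √3) 1) ∧ φ 1 = 1 ∧
    φ (1 / √3) = 2 / √3 ∧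
    ∀ a b, (a, b) ∈ closedCurve ↔ b ∈ Icc (1 / √3) 1 ∧ a = φ b := by
  choose! φ hφ using fun b (hb : b ∈ Icc (1 / √3) 1) => exists_mem_closedCurve hb
  have hiff : ∀ a b, (a, b) ∈ closedCurve ↔ b ∈ Icc (1 / √3) 1 ∧ a = φ b := by
    intro a b
    constructor
    · intro h
      have hb : b ∈ Icc (1 / √3) 1 := ⟨h.1.2.2.2.1, h.1.2.2.2.2⟩
      exact ⟨hb, closedCurve_fst_unique h (hφ b hb)⟩
    · rintro ⟨hb, rfl⟩
      exact hφ b hb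
  refine ⟨φ, ?_, ?_, ?_, hiff⟩
  · refine continuousOn_of_isCompact_graph ?_
    convert isCompact_closedCurve.image continuous_swap
    ext ⟨b, a⟩
    simp [hiff]
  · exact ((hiff _ _).1 ⟨one_one_mem_closedRegion, trapezoidD_one_one⟩).2.symm
  · exact ((hiff _ _).1 ⟨corner_mem_closedRegion, trapezoidD_corner⟩).2.symm

/-- The curve is the graph of a continuous function of `a`. -/
lemma exists_graph_fst : ∃ ψ : ℝ → ℝ, ContinuousOn ψ (Icc 1 (2 / √3)) ∧ ψ 1 = 1 ∧
    ψ (2 / √3) = 1 / √3 ∧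
    ∀ a b, (a, b) ∈ closedCurve ↔ a ∈ Icc 1 (2 / √3) ∧ b = ψ a := by
  obtain ⟨φ, hφc, hφ1, hφ2, hφ⟩ := exists_graph_snd
  have hex : ∀ a ∈ Icc 1 (2 / √3), ∃ b, (a, b) ∈ closedCurve := by
    intro a ha
    obtain ⟨b, hb, hab⟩ := intermediate_value_Icc' one_div_sqrt_three_lt_one.le hφc
      (by rwa [hφ1, hφ2] : a ∈ Icc (φ 1) (φ (1 / √3)))
    exact ⟨b, (hφ a b).2 ⟨hb, hab.symm⟩⟩
  choose! ψ hψ using hex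
  have hcorner : (2 / √3, 1 / √3) ∈ closedCurve := ⟨corner_mem_closedRegion, trapezoidD_corner⟩
  have hone : ((1, 1) : ℝ × ℝ) ∈ closedCurve := ⟨one_one_mem_closedRegion, trapezoidD_one_one⟩
  have hiff : ∀ a b, (a, b) ∈ closedCurve ↔ a ∈ Icc 1 (2 / √3) ∧ b = ψ a := by
    intro a b
    constructor
    · intro h
      have ha : a ∈ Icc 1 (2 / √3) := by
        refine ⟨one_le_of_mem_closedRegion h.1, ?_⟩
        rcases (h.1.2.2.2.1 : 1 / √3 ≤ b).eq_or_lt with rfl | hb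
        · exact (closedCurve_fst_unique h hcorner).le
        · exact (closedCurve_fst_lt hcorner h hb).le
      refine ⟨ha, ?_⟩
      rcases lt_trichotomy b (ψ a) with hlt | heq | hlt
      · exact absurd (closedCurve_fst_lt h (hψ a ha) hlt) (lt_irrefl a)
      · exact heq
      · exact absurd (closedCurve_fst_lt (hψ a ha) h hlt) (lt_irrefl a)
    · rintro ⟨ha, rfl⟩
      exact hψ a ha
  refine ⟨ψ, ?_, ((hiff _ _).1 hone).2.symm, ((hiff _ _).1 hcorner).2.symm, hiff⟩
  refine continuousOn_of_isCompact_graph ?_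
  convert isCompact_closedCurve
  ext ⟨a, b⟩
  simp [hiff]

/-! ### Central configurations -/

/-- The equations of a central configuration in terms of the mutual positions only. -/
lemma newtonAcceleration_eq_iff {n : ℕ} {m : Fin n → ℝ} {q : Fin n → EuclideanSpace ℝ (Fin 2)}
    (hM : ∑ j, m j ≠ 0) (lam : ℝ) (k : Fin n) :
    newtonAcceleration m q k = -(lam • (q k - massCenter m q)) ↔
      ∑ j, (m j * (1 / dist (q k) (q j) ^ 3 - lam / ∑ i, m i)) • (q k - q j) = 0 := by
  have hcenter : lam • (q k - massCenter m q)
      = ∑ j, (m j * (lam / ∑ i, m i)) • (q k - q j) := by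
    have h1 : ∑ j, (m j * (lam / ∑ i, m i)) • (q k - q j)
        = (lam / ∑ i, m i) • ((∑ j, m j) • q k - ∑ j, m j • q j) := by
      rw [Finset.sum_smul, ← Finset.sum_sub_distrib, Finset.smul_sum]
      refine Finset.sum_congr rfl fun j _ => ?_
      rw [← smul_sub, smul_smul, mul_comm]
    rw [h1, massCenter, smul_sub, smul_sub, smul_smul, smul_smul, div_mul_cancel₀ _ hM,
      div_eq_mul_inv]
  have hacc : newtonAcceleration m q k
      = -∑ j, (m j * (1 / dist (q k) (q j) ^ 3)) • (q k - q j) := by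
    rw [newtonAcceleration, ← Finset.add_sum_erase _ _ (Finset.mem_univ k), sub_self, smul_zero,
      zero_add]
    simp only [mul_one_div]
  simp only [mul_sub, sub_smul, Finset.sum_sub_distrib]
  rw [← hcenter, hacc, neg_inj, sub_eq_zero]

lemma rightTrapezoid_injective {a b : ℝ} (ha : 0 < a) (hb : 0 < b) :
    Function.Injective (rightTrapezoid a b) := by
  intro i j hij
  have h0 : rightTrapezoid a b i 0 = rightTrapezoid a b j 0 := by rw [hij]
  have h1 : rightTrapezoid a b i 1 = rightTrapezoid a b j 1 := by rw [hij]
  fin_cases i <;> fin_cases j <;> simp_all [rightTrapezoid, ha.ne, ha.ne', hb.ne, hb.ne']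

/-- The equations of a central configuration for a right trapezoid, with `μ = lam / M` for the total
mass `M`. For each body, the horizontal component comes first; the vertical components of the
second and third bodies are simplified by means of the horizontal ones. -/
lemma isCentralConfiguration_rightTrapezoid_iff {a b : ℝ} (ha : 0 < a) (hb : 0 < b)
    {m : Fin 4 → ℝ} (hm : ∀ i, 0 < m i) :
    IsCentralConfiguration m (rightTrapezoid a b) ↔ ∃ μ : ℝ, 0 < μ ∧
      m 2 * (1 / √(1 + b ^ 2) ^ 3 - μ) + m 3 * (1 - μ) = 0 ∧
      a * m 1 * (1 / a ^ 3 - μ) + b * m 2 * (1 / √(1 + b ^ 2) ^ 3 - μ) = 0 ∧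
      m 2 * (1 / √(1 + (a - b) ^ 2) ^ 3 - μ) + m 3 * (1 / √(1 + a ^ 2) ^ 3 - μ) = 0 ∧
      a * m 0 * (1 / a ^ 3 - μ) - b * m 2 * (1 / √(1 + (a - b) ^ 2) ^ 3 - μ) = 0 ∧
      m 0 * (1 / √(1 + b ^ 2) ^ 3 - μ) + m 1 * (1 / √(1 + (a - b) ^ 2) ^ 3 - μ) = 0 ∧
      b * m 3 * (1 / b ^ 3 - μ) - a * m 1 * (1 / √(1 + (a - b) ^ 2) ^ 3 - μ) = 0 ∧
      m 0 * (1 - μ) + m 1 * (1 / √(1 + a ^ 2) ^ 3 - μ) = 0 ∧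
      a * m 1 * (1 / √(1 + a ^ 2) ^ 3 - μ) + b * m 2 * (1 / b ^ 3 - μ) = 0 := by
  have hM : 0 < ∑ j, m j := Finset.sum_pos (fun i _ => hm i) Finset.univ_nonempty
  have heq : ∀ μ : ℝ, (∀ k, ∑ j, (m j * (1 / dist (rightTrapezoid a b k) (rightTrapezoid a b j) ^ 3
        - μ)) • (rightTrapezoid a b k - rightTrapezoid a b j) = 0) ↔
      m 2 * (1 / √(1 + b ^ 2) ^ 3 - μ) + m 3 * (1 - μ) = 0 ∧
      a * m 1 * (1 / a ^ 3 - μ) + b * m 2 * (1 / √(1 + b ^ 2) ^ 3 - μ) = 0 ∧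
      m 2 * (1 / √(1 + (a - b) ^ 2) ^ 3 - μ) + m 3 * (1 / √(1 + a ^ 2) ^ 3 - μ) = 0 ∧
      a * m 0 * (1 / a ^ 3 - μ) - b * m 2 * (1 / √(1 + (a - b) ^ 2) ^ 3 - μ) = 0 ∧
      m 0 * (1 / √(1 + b ^ 2) ^ 3 - μ) + m 1 * (1 / √(1 + (a - b) ^ 2) ^ 3 - μ) = 0 ∧
      b * m 3 * (1 / b ^ 3 - μ) - a * m 1 * (1 / √(1 + (a - b) ^ 2) ^ 3 - μ) = 0 ∧
      m 0 * (1 - μ) + m 1 * (1 / √(1 + a ^ 2) ^ 3 - μ) = 0 ∧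
      a * m 1 * (1 / √(1 + a ^ 2) ^ 3 - μ) + b * m 2 * (1 / b ^ 3 - μ) = 0 := by
    intro μ
    have hvec : ∀ v : EuclideanSpace ℝ (Fin 2), v = 0 ↔ v 0 = 0 ∧ v 1 = 0 := fun v => by
      constructor
      · rintro rfl; simp
      · rintro ⟨h0, h1⟩; ext i; fin_cases i <;> simpa
    simp only [hvec, Fin.forall_fin_succ, Fin.sum_univ_four]
    simp only [Fin.isValue, Fin.succ_zero_eq_one, Fin.succ_one_eq_two, IsEmpty.forall_iff, and_true,
      show (Fin.succ 2 : Fin 4) = 3 from rfl, PiLp.add_apply, PiLp.smul_apply, PiLp.sub_apply,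
      smul_eq_mul]
    simp only [dist_comm (rightTrapezoid a b 1) (rightTrapezoid a b 0),
      dist_comm (rightTrapezoid a b 2) (rightTrapezoid a b 0),
      dist_comm (rightTrapezoid a b 3) (rightTrapezoid a b 0),
      dist_comm (rightTrapezoid a b 2) (rightTrapezoid a b 1),
      dist_comm (rightTrapezoid a b 3) (rightTrapezoid a b 1),
      dist_comm (rightTrapezoid a b 3) (rightTrapezoid a b 2),
      dist_rightTrapezoid_zero_one ha, dist_rightTrapezoid_zero_two,
      dist_rightTrapezoid_zero_three, dist_rightTrapezoid_one_two, dist_rightTrapezoid_one_three,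
      dist_rightTrapezoid_two_three hb, one_pow, sub_self, mul_zero]
    simp [rightTrapezoid]
    constructor
    · rintro ⟨⟨h1, h2⟩, ⟨h3, h4⟩, ⟨h5, h6⟩, h7, h8⟩
      refine ⟨?_, ?_, ?_, ?_, h5, ?_, h7, ?_⟩
      · linear_combination -h1
      · linear_combination -h2
      · linear_combination -h3
      · linear_combination h4 + a * h3
      · linear_combination h6 - b * h5
      · linear_combination -h8
    · rintro ⟨h1, h2, h3, h4, h5, h6, h7, h8⟩
      refine ⟨⟨?_, ?_⟩, ⟨?_, ?_⟩, ⟨h5, ?_⟩, h7, ?_⟩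
      · linear_combination -h1
      · linear_combination -h2
      · linear_combination -h3
      · linear_combination h4 + a * h3
      · linear_combination h6 + b * h5
      · linear_combination -h8
  refine ⟨?_, ?_⟩
  · rintro ⟨-, lam, hlam, h⟩
    exact ⟨lam / ∑ j, m j, div_pos hlam hM,
      (heq _).1 fun k => (newtonAcceleration_eq_iff hM.ne' lam k).1 (h k)⟩
  · rintro ⟨μ, hμ, h⟩
    refine ⟨rightTrapezoid_injective ha hb, μ * ∑ j, m j, mul_pos hμ hM, fun k => ?_⟩
    rw [newtonAcceleration_eq_iff hM.ne', mul_div_cancel_right₀ _ hM.ne']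
    exact (heq μ).2 h k

/-- If both products `q * q'` and `r * r'` agree, Dziobek's expression in the shifted reciprocal
cubes splits off the difference of the two remaining products. -/
lemma dziobek_identity {p p' q q' r r' : ℝ} (h : q * q' = r * r') :
    (q - p) * (r' - p') * (q' - r) - (p - r) * (q' - p') * (q - r')
      = (q + q' - r - r') * (p * p' - q * q') := by
  linear_combination (q + q' - p - p') * h

/-- If both `q, q'` lie below both `r, r'`, then some `μ` in between makes
the shifted products equal. -/
lemma exists_shift {q q' r r' : ℝ} (h1 : q < r) (h2 : q < r') (h3 : q' < r) (h4 : q' < r') :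
    ∃ μ, q < μ ∧ q' < μ ∧ μ < r ∧ μ < r' ∧ (q - μ) * (q' - μ) = (r - μ) * (r' - μ) := by
  have hpos : 0 < r + r' - q - q' := by linarith
  refine ⟨(r * r' - q * q') / (r + r' - q - q'), ?_, ?_, ?_, ?_, ?_⟩
  · rw [lt_div_iff₀ hpos]
    linear_combination mul_pos (sub_pos.2 h1) (sub_pos.2 h2)
  · rw [lt_div_iff₀ hpos]
    linear_combination mul_pos (sub_pos.2 h3) (sub_pos.2 h4)
  · rw [div_lt_iff₀ hpos]
    linear_combination mul_pos (sub_pos.2 h1) (sub_pos.2 h3)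
  · rw [div_lt_iff₀ hpos]
    linear_combination mul_pos (sub_pos.2 h2) (sub_pos.2 h4)
  · have := div_mul_cancel₀ (r * r' - q * q') hpos.ne'
    linear_combination this

/-- Dziobek's expression in the distances is, up to a nonzero factor, the same expression in the
shifted reciprocal cubes. -/
lemma trapezoidD_eq (a b μ : ℝ) (ha : 0 < a) (hb : 0 < b) :
    trapezoidD a b = -(a ^ 3 * b ^ 3 * √(1 + b ^ 2) ^ 3 * √(1 + a ^ 2) ^ 3
      * √(1 + (a - b) ^ 2) ^ 3) *
      (((1 / √(1 + b ^ 2) ^ 3 - μ) - (1 / a ^ 3 - μ))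
          * ((1 / √(1 + (a - b) ^ 2) ^ 3 - μ) - (1 / b ^ 3 - μ))
          * ((1 / √(1 + a ^ 2) ^ 3 - μ) - (1 - μ))
        - ((1 / a ^ 3 - μ) - (1 - μ)) * ((1 / √(1 + a ^ 2) ^ 3 - μ) - (1 / b ^ 3 - μ))
          * ((1 / √(1 + b ^ 2) ^ 3 - μ) - (1 / √(1 + (a - b) ^ 2) ^ 3 - μ))) := by
  have hu : 0 < √(1 + b ^ 2) := by positivity
  have hw : 0 < √(1 + a ^ 2) := by positivity
  have hs : 0 < √(1 + (a - b) ^ 2) := by positivity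
  unfold trapezoidD
  generalize √(1 + b ^ 2) = u at *
  generalize √(1 + a ^ 2) = w at *
  generalize √(1 + (a - b) ^ 2) = s at *
  field_simp
  ring

/-- The masses cancel from the equations of a central configuration, which leaves equal products
over the three pairs of opposite edges. -/
lemma trapezoidD_eq_zero_of_central {a b : ℝ} (ha : 0 < a) (hb : 0 < b) {m : Fin 4 → ℝ}
    (hm : ∀ i, 0 < m i) (h : IsCentralConfiguration m (rightTrapezoid a b)) :
    trapezoidD a b = 0 := by
  obtain ⟨μ, -, e1, e2, e3, -, -, -, -, e8⟩ :=
    (isCentralConfiguration_rightTrapezoid_iff ha hb hm).1 h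
  rw [trapezoidD_eq a b μ ha hb]
  generalize 1 / √(1 + b ^ 2) ^ 3 - μ = q at *
  generalize 1 / √(1 + a ^ 2) ^ 3 - μ = q' at *
  generalize 1 / √(1 + (a - b) ^ 2) ^ 3 - μ = r' at *
  generalize 1 / a ^ 3 - μ = p at *
  generalize 1 / b ^ 3 - μ = p' at *
  generalize 1 - μ = r at *
  have hqr : q * q' = r * r' := by
    refine mul_left_cancel₀ (mul_pos (hm 2) (hm 3)).ne' ?_
    linear_combination m 3 * q' * e1 - m 3 * r * e3
  have hpq : p * p' = q * q' := by
    refine mul_left_cancel₀ (mul_pos (mul_pos ha (hm 1)) (mul_pos hb (hm 2))).ne' ?_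
    linear_combination b * m 2 * p' * e2 - b * m 2 * q * e8
  rw [dziobek_identity hqr, hpq, sub_self, mul_zero, mul_zero]

/-- With `μ` from `exists_shift`, the equation `D = 0` says that the product over the pair
`(1, 2), (3, 4)` agrees with the two others, so the masses can be solved for; they are positive by
the signs of the six shifted reciprocal cubes. -/
lemma exists_masses {a b : ℝ} (h : (a, b) ∈ rightRegion) (hD : trapezoidD a b = 0) :
    ∃ m : Fin 4 → ℝ, m 0 = 1 ∧ (∀ i, 0 < m i) ∧
      IsCentralConfiguration m (rightTrapezoid a b) := by
  obtain ⟨h1, h2, h3⟩ := mem_rightRegion_iff.1 h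
  have hT := trapezoidDistances_of_mem h1 h3 h2
  have ha := hT.a_pos
  have hb := hT.b_pos
  have lt_inv : ∀ x y : ℝ, 0 < x → x < y → 1 / y ^ 3 < 1 / x ^ 3 := fun x y hx hxy =>
    one_div_lt_one_div_of_lt (by positivity) (pow_lt_pow_left₀ hxy hx.le three_ne_zero)
  have hsu := hT.s_le_a.trans_lt hT.a_lt_u
  have hu1 := hT.one_le_a.trans_lt hT.a_lt_u
  have hone : (1 : ℝ) = 1 / 1 ^ 3 := by norm_num
  obtain ⟨μ, hq, hq', hr, hr', hqr⟩ := exists_shift (q := 1 / √(1 + b ^ 2) ^ 3)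
    (q' := 1 / √(1 + a ^ 2) ^ 3) (r := 1) (r' := 1 / √(1 + (a - b) ^ 2) ^ 3)
    (by rw [hone]; simpa using lt_inv 1 _ one_pos hu1)
    (lt_inv _ _ hT.s_pos hsu)
    (by rw [hone]; simpa using lt_inv 1 _ one_pos (hu1.trans_le hT.u_le_w))
    (lt_inv _ _ hT.s_pos (hsu.trans_le hT.u_le_w))
  have hμ : 0 < μ := lt_trans (by have := hT.u_pos; positivity) hq
  have hp' : μ < 1 / b ^ 3 := by
    refine hr.trans_le ?_
    rw [le_div_iff₀ (by positivity), one_mul]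
    exact pow_le_one₀ hb.le hT.b_le
  rw [trapezoidD_eq a b μ ha hb, dziobek_identity hqr] at hD
  have hfac : a ^ 3 * b ^ 3 * √(1 + b ^ 2) ^ 3 * √(1 + a ^ 2) ^ 3 * √(1 + (a - b) ^ 2) ^ 3 ≠ 0 := by
    positivity
  have hpq : (1 / a ^ 3 - μ) * (1 / b ^ 3 - μ)
      = (1 / √(1 + b ^ 2) ^ 3 - μ) * (1 / √(1 + a ^ 2) ^ 3 - μ) := by
    have h4 := (mul_eq_zero.1 hD).resolve_left (neg_ne_zero.2 hfac)
    exact sub_eq_zero.1 ((mul_eq_zero.1 h4).resolve_left (by linarith))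
  refine ⟨![1,
    -(1 / √(1 + b ^ 2) ^ 3 - μ) / (1 / √(1 + (a - b) ^ 2) ^ 3 - μ),
    a * (1 / a ^ 3 - μ) / (b * (1 / √(1 + (a - b) ^ 2) ^ 3 - μ)),
    -(a * (1 / a ^ 3 - μ) * (1 / √(1 + b ^ 2) ^ 3 - μ)) /
      (b * (1 - μ) * (1 / √(1 + (a - b) ^ 2) ^ 3 - μ))], rfl,
    (and_congr_right fun hm => isCentralConfiguration_rightTrapezoid_iff ha hb hm).2 ?_⟩
  refine And.imp_right (fun H => ⟨μ, hμ, H⟩) ?_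
  rw [← sub_neg] at hq hq'
  rw [← sub_pos] at hr hr' hp'
  generalize 1 / √(1 + b ^ 2) ^ 3 - μ = q at *
  generalize 1 / √(1 + a ^ 2) ^ 3 - μ = q' at *
  generalize 1 / √(1 + (a - b) ^ 2) ^ 3 - μ = r' at *
  generalize 1 / a ^ 3 - μ = p at *
  generalize 1 / b ^ 3 - μ = p' at *
  generalize 1 - μ = r at *
  have hp : 0 < p := pos_of_mul_pos_left (hpq ▸ mul_pos_of_neg_of_neg hq hq') hp'.le
  have hq0 : 0 < -q := neg_pos.2 hq
  have hm3 : 0 < -(a * p * q) / (b * r * r') := by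
    rw [← mul_neg]
    positivity
  have hr0 := hr.ne'
  have hr0' := hr'.ne'
  have hb0 := hb.ne'
  refine ⟨fun i => ?_, ?_⟩
  · fin_cases i
    · exact one_pos
    · exact div_pos hq0 hr'
    · exact div_pos (mul_pos ha hp) (mul_pos hb hr')
    · exact hm3
  simp only [Matrix.cons_val]
  refine ⟨?_, ?_, ?_, ?_, ?_, ?_, ?_, ?_⟩
  · field_simp
    ring
  · field_simp
    ring
  · field_simp
    linear_combination -(a * p) * hqr
  · field_simp
    ring
  · field_simp
    ring
  · field_simp
    linear_combination -(a * q) * hqr - a * q * hpq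
  · field_simp
    linear_combination -hqr
  · field_simp
    linear_combination a * hpq

theorem theorem6p1 :
    -- the partial derivative of `D` with respect to `a` is negative on the curve
    (∀ a b : ℝ, (a, b) ∈ rightCurve →
      DifferentiableAt ℝ (fun x => dziobek (rightTrapezoid x b)) a ∧
        deriv (fun x => dziobek (rightTrapezoid x b)) a < 0) ∧
    -- the curve is the graph of a continuous `a = φ(b)` joining `(1, 1)` to `(2/√3, 1/√3)`
    (∃ φ : ℝ → ℝ, ContinuousOn φ (Icc (1 / √3) 1) ∧ φ 1 = 1 ∧ φ (1 / √3) = 2 / √3 ∧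
      rightCurve = {p : ℝ × ℝ | p.2 ∈ Ioc (1 / √3) 1 ∧ p.1 = φ p.2}) ∧
    -- it is also the graph of a continuous `b = ψ(a)` joining the same points
    (∃ ψ : ℝ → ℝ, ContinuousOn ψ (Icc 1 (2 / √3)) ∧ ψ 1 = 1 ∧ ψ (2 / √3) = 1 / √3 ∧
      rightCurve = {p : ℝ × ℝ | p.1 ∈ Ico 1 (2 / √3) ∧ p.2 = ψ p.1}) ∧
    -- its points are exactly the central configurations with positive masses in the region
    (∀ a b : ℝ, (a, b) ∈ rightRegion →
      ((a, b) ∈ rightCurve ↔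
        ∃ m : Fin 4 → ℝ, m 0 = 1 ∧ (∀ i, 0 < m i) ∧
          IsCentralConfiguration m (rightTrapezoid a b))) := by
  refine ⟨?_, ?_, ?_, ?_⟩
  · intro a b h
    obtain ⟨h1, h2, h3⟩ := mem_rightRegion_iff.1 h.1
    have hT := trapezoidDistances_of_mem h1 h3 h2
    have hev : (fun x => dziobek (rightTrapezoid x b)) =ᶠ[nhds a] fun x => trapezoidD x b := by
      filter_upwards [lt_mem_nhds hT.a_pos] with x hx
      exact dziobek_rightTrapezoid hx hT.b_pos
    have hd := (hasDerivAt_trapezoidD_left a b).congr_of_eventuallyEq hev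
    refine ⟨hd.differentiableAt, ?_⟩
    rw [hd.deriv]
    linarith [hT.partial_a_pos]
  · obtain ⟨φ, hc, h1, h2, hφ⟩ := exists_graph_snd
    refine ⟨φ, hc, h1, h2, ?_⟩
    ext ⟨a, b⟩
    rw [mem_rightCurve_iff, hφ]
    exact ⟨fun h => ⟨⟨h.2, h.1.1.2⟩, h.1.2⟩, fun h => ⟨⟨⟨h.1.1.le, h.1.2⟩, h.2⟩, h.1.1⟩⟩
  · obtain ⟨ψ, hc, h1, h2, hψ⟩ := exists_graph_fst
    refine ⟨ψ, hc, h1, h2, ?_⟩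
    have hcorner : (2 / √3, 1 / √3) ∈ closedCurve := ⟨corner_mem_closedRegion, trapezoidD_corner⟩
    ext ⟨a, b⟩
    rw [mem_rightCurve_iff]
    constructor
    · rintro ⟨h, hb⟩
      have h' := (hψ a b).1 h
      exact ⟨⟨h'.1.1, closedCurve_fst_lt hcorner h hb⟩, h'.2⟩
    · rintro ⟨⟨ha1, ha2⟩, hb⟩
      dsimp only at ha1 ha2 hb
      have h : (a, b) ∈ closedCurve := (hψ a b).2 ⟨⟨ha1, ha2.le⟩, hb⟩
      refine ⟨h, (h.1.2.2.2.1 : 1 / √3 ≤ b).lt_of_ne ?_⟩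
      rintro rfl
      exact ha2.ne (closedCurve_fst_unique h hcorner)
  · intro a b h
    obtain ⟨h1, -, h3⟩ := mem_rightRegion_iff.1 h
    obtain ⟨ha, hb⟩ := mem_closedRegion_pos h1
    refine ⟨fun hc => exists_masses h (mem_rightCurve_iff.1 hc).1.2, ?_⟩
    rintro ⟨m, -, hm, hcc⟩
    exact mem_rightCurve_iff.2 ⟨⟨h1, trapezoidD_eq_zero_of_central ha hb hm hcc⟩, h3⟩
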